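/- Let $\mathcal H,\mathcal K$ be complex Hilbert spaces, let $J\subseteq\mathbb R$ be an interval and let $f:J\to\mathbb R$ be a convex function. Let $A_1,\dots,A_n\in\mathcal B(\mathcal H)$ be self-adjoint operators with spectra contained in $J$ such that $f$ is continuous on each of these spectra (so that $f(A_i)$ is defined by the continuous functional calculus), and let $\Phi_1,\dots,\Phi_n:\mathcal B(\mathcal H)\to\mathcal B(\mathcal K)$ be positive linear maps with $\sum_{i=1}^n\Phi_i(\mathbf 1_{\mathcal H})=\mathbf 1_{\mathcal K}$. Put $S=\sum_{i=1}^n\Phi_i(A_i)$. Let $s\mapsto C_s$ be any choice of real numbers such that $$C_s(t-s)+f(s)\le f(t)\qquad\text{for all } s\in \mathrm{sp}(S)\text{ and all } t\in J$$ (the spectrum $\mathrm{sp}(S)$ is contained in $J$, and such a choice is automatically bounded and Borel measurable on it), and let $C_S\in\mathcal B(\mathcal K)$ be the operator obtained by applying the function $s\mapsto C_s$ to $S$ through the Borel functional calculus. Then the set $$\left\{\langle C_S S x,x\rangle-\langle Sx,x\rangle\langle C_S x,x\rangle:\ x\in\mathcal K,\ \|x\|=1\right\}$$ is bounded above and, with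 $\zeta$ its supremum (and $\zeta=0$ if $\mathcal K=\{0\}$), $$f\Big(\sum_{i=1}^n\Phi_i(A_i)\Big)\le\sum_{i=1}^n\Phi_i(f(A_i))+\zeta\,\mathbf 1_{\mathcal K}.$$ -/

import Mathlib

open scoped InnerProductSpace CompactlySupported

noncomputable section

section BorelFunctionalCalculus

variable {K : Type*} [NormedAddCommGroup K] [InnerProductSpace ℂ K] [CompleteSpace K]

/-- For a self-adjoint operator `T` and a vector `x`, the positive linear functional
`h ↦ ⟨h(T) x, x⟩` on the continuous real functions on the (compact) spectrum of `T`. -/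
def spectralFunctional (T : K →L[ℂ] K) (hT : IsSelfAdjoint T) (x : K) :
    C_c(spectrum ℝ T, ℝ) →ₚ[ℝ] ℝ :=
  PositiveLinearMap.mk₀
    { toFun := fun h => (⟪x, cfcHom hT (h : C(spectrum ℝ T, ℝ)) x⟫_ℂ).re
      map_add' := fun h k => by
        have : ((h + k : C_c(spectrum ℝ T, ℝ)) : C(spectrum ℝ T, ℝ))
            = (h : C(spectrum ℝ T, ℝ)) + (k : C(spectrum ℝ T, ℝ)) := rfl
        rw [this, map_add]
        simp
      map_smul' := fun c h => by
        have : ((c • h : C_c(spectrum ℝ T, ℝ)) : C(spectrum ℝ T, ℝ))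
            = c • (h : C(spectrum ℝ T, ℝ)) := rfl
        rw [this, map_smul]
        simp [inner_smul_right_eq_smul] }
    (fun h hh => by
      have h0 : (0 : C(spectrum ℝ T, ℝ)) ≤ (h : C(spectrum ℝ T, ℝ)) := fun t => hh t
      have h1 : (0 : K →L[ℂ] K) ≤ cfcHom hT (h : C(spectrum ℝ T, ℝ)) := by
        simpa using cfcHom_mono hT h0
      rw [ContinuousLinearMap.nonneg_iff_isPositive] at h1
      exact h1.re_inner_nonneg_right x)

open Classical in
/-- The spectral measure of a self-adjoint operator `T` at the vector `x`: the Riesz measure `μ_x`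
on the spectrum of `T` with `∫ h dμ_x = ⟨h(T) x, x⟩` for all continuous `h`.
(The value is `0` if `T` is not self-adjoint.) -/
def spectralMeasure (T : K →L[ℂ] K) (x : K) : MeasureTheory.Measure (spectrum ℝ T) :=
  if hT : IsSelfAdjoint T then RealRMK.rieszMeasure (spectralFunctional T hT x) else 0

theorem integral_spectralMeasure (T : K →L[ℂ] K) (hT : IsSelfAdjoint T) (x : K)
    (h : C(spectrum ℝ T, ℝ)) :
    ∫ t, h t ∂(spectralMeasure T x) = (⟪x, cfcHom hT h x⟫_ℂ).re := by
  rw [spectralMeasure, dif_pos hT]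
  exact RealRMK.integral_rieszMeasure (spectralFunctional T hT x)
    (CompactlySupportedContinuousMap.continuousMapEquiv h)

instance isFiniteMeasure_spectralMeasure (T : K →L[ℂ] K) (x : K) :
    MeasureTheory.IsFiniteMeasure (spectralMeasure T x) := by
  unfold spectralMeasure
  split_ifs with hT
  · refine ⟨?_⟩
    exact isCompact_univ.measure_lt_top
  · infer_instance

open Classical in
/-- The Borel functional calculus of a self-adjoint operator `T`: for `g` bounded and Borel on the
spectrum of `T`, this is the operator `g(T)` determined by `⟨g(T) x, x⟩ = ∫ g dμ_x` for all `x`,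
where `μ_x` is the spectral measure of `T` at `x`. -/
def borelCalculus (g : ℝ → ℝ) (T : K →L[ℂ] K) : K →L[ℂ] K :=
  if h : ∃ R : K →L[ℂ] K,
      ∀ x, ⟪R x, x⟫_ℂ = ((∫ t, g t ∂(spectralMeasure T x) : ℝ) : ℂ) then h.choose else 0

theorem exists_continuous_approx {X : Type*} [TopologicalSpace X] [CompactSpace X]
    [TopologicalSpace.PseudoMetrizableSpace X] [MeasurableSpace X] [BorelSpace X]
    {I : Type*} (μ : I → MeasureTheory.Measure X) [∀ i, MeasureTheory.IsFiniteMeasure (μ i)]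
    (g : X → ℝ) (hg : Measurable g) (M : ℝ) (hM : ∀ t, |g t| ≤ M) (s : Finset I) (ε : ℝ)
    (hε : 0 < ε) :
    ∃ h : C(X, ℝ), (∀ t, |h t| ≤ M) ∧
      ∀ i ∈ s, |(∫ t, h t ∂(μ i)) - ∫ t, g t ∂(μ i)| ≤ ε := by
  have hint : ∀ (ν : MeasureTheory.Measure X) [MeasureTheory.IsFiniteMeasure ν] (u : X → ℝ),
      Measurable u → (∀ t, |u t| ≤ M) → MeasureTheory.Integrable u ν := fun ν _ u hu hb =>
    MeasureTheory.Integrable.of_bound hu.aestronglyMeasurable M (Filter.Eventually.of_forall hb)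
  set ν : MeasureTheory.Measure X := ∑ i ∈ s, μ i with hν
  obtain ⟨h0, hh0, hh0i⟩ :=
    (hint ν g hg hM).exists_boundedContinuous_integral_sub_le hε
  let h : C(X, ℝ) := ⟨fun t => max (-M) (min (h0 t) M), by fun_prop⟩
  have hb : ∀ t, |h t| ≤ M := fun t => by
    have := (abs_nonneg _).trans (hM t)
    simp only [h, ContinuousMap.coe_mk, abs_le]
    exact ⟨le_max_left _ _, max_le (by linarith) (min_le_right _ _)⟩
  have hle : ∀ t, |g t - h t| ≤ |g t - h0 t| := fun t => by
    have h2 := abs_le.1 (hM t)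
    simp only [h, ContinuousMap.coe_mk]
    grind
  refine ⟨h, hb, fun i hi => ?_⟩
  have hIg := hint (μ i) g hg hM
  have hIh := hint (μ i) h h.continuous.measurable hb
  have hI0 : MeasureTheory.Integrable (fun t => ‖g t - h0 t‖) ν :=
    ((hint ν g hg hM).sub hh0i).norm
  have hI0j : ∀ j ∈ s, MeasureTheory.Integrable (fun t => ‖g t - h0 t‖) (μ j) :=
    MeasureTheory.integrable_finsetSum_measure.1 hI0
  rw [abs_sub_comm, ← MeasureTheory.integral_sub hIg hIh]
  calc |∫ t, (g t - h t) ∂(μ i)| ≤ ∫ t, |g t - h t| ∂(μ i) := MeasureTheory.abs_integral_le_integral_abs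
    _ ≤ ∫ t, ‖g t - h0 t‖ ∂(μ i) :=
        MeasureTheory.integral_mono (hIg.sub hIh).abs (hI0j i hi) hle
    _ ≤ ∑ j ∈ s, ∫ t, ‖g t - h0 t‖ ∂(μ j) :=
        Finset.single_le_sum (f := fun j => ∫ t, ‖g t - h0 t‖ ∂(μ j))
          (fun j _ => MeasureTheory.integral_nonneg fun t => norm_nonneg _) hi
    _ = ∫ t, ‖g t - h0 t‖ ∂ν := (MeasureTheory.integral_finsetSum_measure hI0j).symm
    _ ≤ ε := hh0

/-- The Borel functional calculus is well defined on bounded Borel functions. -/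
theorem exists_borelCalculus (T : K →L[ℂ] K) (hT : IsSelfAdjoint T) (g : ℝ → ℝ)
    (hg : Measurable fun t : spectrum ℝ T => g t) (M : ℝ) (hM : ∀ t ∈ spectrum ℝ T, |g t| ≤ M) :
    ∃ R : K →L[ℂ] K,
      ∀ x, ⟪R x, x⟫_ℂ = ((∫ t, g t ∂(spectralMeasure T x) : ℝ) : ℂ) := by
  classical
  have key : ∀ p : Finset K × ℕ, ∃ h : C(spectrum ℝ T, ℝ), (∀ t, |h t| ≤ |M|) ∧
      ∀ x ∈ p.1, |(∫ t, h t ∂(spectralMeasure T x)) - ∫ t, g t ∂(spectralMeasure T x)|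
        ≤ 1 / ((p.2 : ℝ) + 1) := fun p =>
    exists_continuous_approx (spectralMeasure T) (fun t : spectrum ℝ T => g t) hg |M|
      (fun t => (hM t t.2).trans (le_abs_self M)) p.1 _ (by positivity)
  choose h hb hh using key
  let R : Finset K × ℕ → (K →L[ℂ] K) := fun p => cfcHom hT (h p)
  have hsa : ∀ p, IsSelfAdjoint (R p) := fun p => cfcHom_predicate hT (h p)
  have hnorm : ∀ p, ‖R p‖ ≤ |M| := fun p => by
    refine ((norm_cfcHom T (h p) hT).le).trans ?_
    exact (ContinuousMap.norm_le _ (abs_nonneg M)).2 (hb p)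
  have hdiag : ∀ x, Filter.Tendsto (fun p => ⟪R p x, x⟫_ℂ) Filter.atTop
      (nhds ((∫ t, g t ∂(spectralMeasure T x) : ℝ) : ℂ)) := fun x => by
    have e : ∀ p, ⟪R p x, x⟫_ℂ = ((∫ t, h p t ∂(spectralMeasure T x) : ℝ) : ℂ) := fun p => by
      rw [integral_spectralMeasure T hT x]
      have := (hsa p).isSymmetric.coe_re_inner_apply_self x
      have h2 := (hsa p).isSymmetric x x
      simp only [ContinuousLinearMap.coe_coe] at this h2
      rw [← h2]
      exact this.symm
    simp_rw [e]
    refine (Complex.continuous_ofReal.tendsto _).comp ?_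
    rw [tendsto_iff_dist_tendsto_zero]
    have hz : Filter.Tendsto (fun p : Finset K × ℕ => 1 / ((p.2 : ℝ) + 1)) Filter.atTop
        (nhds 0) := by
      rw [← Filter.prod_atTop_atTop_eq]
      exact tendsto_one_div_add_atTop_nhds_zero_nat.comp Filter.tendsto_snd
    refine squeeze_zero' (Filter.Eventually.of_forall fun p => dist_nonneg) ?_ hz
    filter_upwards [Filter.eventually_ge_atTop (({x}, 0) : Finset K × ℕ)] with p hp
    exact hh p x (hp.1 (Finset.mem_singleton_self x))
  have hpol : ∀ v w, ∃ l, Filter.Tendsto (fun p => ⟪R p v, w⟫_ℂ) Filter.atTop (nhds l) :=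
    fun v w => by
      have := fun p => inner_map_polarization' ((R p : K →L[ℂ] K) : K →ₗ[ℂ] K) v w
      simp only [ContinuousLinearMap.coe_coe] at this
      simp_rw [this]
      exact ⟨_, ((((hdiag _).sub (hdiag _)).sub ((hdiag _).const_mul _)).add
        ((hdiag _).const_mul _)).div_const 4⟩
  choose B hB using hpol
  let L : K →L⋆[ℂ] K →L[ℂ] ℂ := LinearMap.mkContinuous₂
    (LinearMap.mk₂'ₛₗ (starRingEnd ℂ) (RingHom.id ℂ) B
      (fun v v' w => tendsto_nhds_unique (hB _ _) (by
        simpa [inner_add_left] using (hB v w).add (hB v' w)))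
      (fun c v w => tendsto_nhds_unique (hB _ _) (by
        simpa [inner_smul_left, mul_comm] using (hB v w).const_mul (starRingEnd ℂ c)))
      (fun v w w' => tendsto_nhds_unique (hB _ _) (by
        simpa [inner_add_right] using (hB v w).add (hB v w')))
      (fun c v w => tendsto_nhds_unique (hB _ _) (by
        simpa [inner_smul_right] using (hB v w).const_mul c)))
    |M| (fun v w => le_of_tendsto (hB v w).norm (Filter.Eventually.of_forall fun p => by
      refine (norm_inner_le_norm _ _).trans ?_
      gcongr
      exact (R p).le_of_opNorm_le (hnorm p) v))
  refine ⟨InnerProductSpace.continuousLinearMapOfBilin L, fun x => ?_⟩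
  rw [InnerProductSpace.continuousLinearMapOfBilin_apply]
  exact tendsto_nhds_unique (hB x x) (hdiag x)

/-- The characteristic property of the Borel functional calculus. -/
theorem inner_borelCalculus (T : K →L[ℂ] K) (hT : IsSelfAdjoint T) (g : ℝ → ℝ)
    (hg : Measurable fun t : spectrum ℝ T => g t) (M : ℝ) (hM : ∀ t ∈ spectrum ℝ T, |g t| ≤ M)
    (x : K) :
    ⟪borelCalculus g T x, x⟫_ℂ = ((∫ t, g t ∂(spectralMeasure T x) : ℝ) : ℂ) := by
  have h := exists_borelCalculus T hT g hg M hM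
  rw [borelCalculus, dif_pos h]
  exact h.choose_spec x

end BorelFunctionalCalculus

/-- The set of all numbers `⟨R S x, x⟩ - ⟨S x, x⟩ ⟨R x, x⟩`, where `x` runs over the unit vectors.
(For commuting self-adjoint `R` and `S` these inner products are real.) -/
def jensenGapSet {K : Type*} [NormedAddCommGroup K] [InnerProductSpace ℂ K]
    (S R : K →L[ℂ] K) : Set ℝ :=
  {r | ∃ x : K, ‖x‖ = 1 ∧
    r = (⟪R (S x), x⟫_ℂ).re - (⟪S x, x⟫_ℂ).re * (⟪R x, x⟫_ℂ).re}

end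

/-!
The values `C s` are slopes of lines supporting `f` at the points `s` of the spectrum of `S`. For a
fixed such `s`, apply the inequality `C s * (t - s) + f s ≤ f t` to the operators `A i` by the
functional calculus, then apply the positive maps `Φ i` and sum: since `∑ Φ i 1 = 1`,
`C s • S + (f s - C s * s) • 1 ≤ ∑ Φ i (f (A i))`. Taking the quadratic form at a unit vector `x`
gives, for every `s` in the spectrum of `S`,
`C s * ⟨S x, x⟩ + f s - C s * s ≤ ∑ ⟨Φ i (f (A i)) x, x⟩`.
The spectral measure of `S` at `x` is a probability measure, and integrating in `s` against it turns
this into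
`⟨S x, x⟩ ⟨C_S x, x⟩ + ⟨f(S) x, x⟩ - ⟨C_S S x, x⟩ ≤ ∑ ⟨Φ i (f (A i)) x, x⟩`,
which is the claim at `x`, the difference of the terms with `C_S` being an element of the gap set.

Three facts make the integration meaningful. The spectrum of `S` lies in `J`
(`spectrum_sum_subset`), where convexity of `J` is used. Slopes of supporting lines are monotone
(`monotoneOn_of_support`), so `C` is Borel and bounded on the spectrum and `f` is Lipschitz there
(`continuousOn_of_support`); in particular `cfc f S` does not take its junk value even if `f` jumps
at an endpoint of `J`. Finally, the Borel functional calculus is only given by its quadratic form,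
so `⟨C_S S x, x⟩ = ∫ C s * s dμ_x` (`re_inner_borelCalculus_apply`) needs an argument: the spectral
measure at `p(S) x` has density `p ^ 2` with respect to that at `x` (`spectralMeasure_cfcHom_apply`),
and the identity follows from it by polarization.
-/

open MeasureTheory

/-! ### Slopes of supporting lines -/

section Support

variable {s : Set ℝ} {f C : ℝ → ℝ}

theorem monotoneOn_of_support (h : ∀ a ∈ s, ∀ b ∈ s, C a * (b - a) + f a ≤ f b) :
    MonotoneOn C s := by
  intro a ha b hb hab
  rcases hab.eq_or_lt with rfl | hlt
  · exact le_rfl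
  · nlinarith [h a ha b hb, h b hb a ha]

theorem exists_bound_of_support (hs : IsCompact s)
    (h : ∀ a ∈ s, ∀ b ∈ s, C a * (b - a) + f a ≤ f b) : ∃ M, ∀ a ∈ s, |C a| ≤ M := by
  rcases s.eq_empty_or_nonempty with rfl | hne
  · exact ⟨0, by simp⟩
  have hm := monotoneOn_of_support h
  obtain ⟨l, hl⟩ := hs.exists_isLeast hne
  obtain ⟨u, hu⟩ := hs.exists_isGreatest hne
  exact ⟨max |C l| |C u|, fun a ha => abs_le_max_abs_abs (hm hl.1 ha (hl.2 ha))
    (hm ha hu.1 (hu.2 ha))⟩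

theorem continuousOn_of_support (hs : IsCompact s)
    (h : ∀ a ∈ s, ∀ b ∈ s, C a * (b - a) + f a ≤ f b) : ContinuousOn f s := by
  obtain ⟨M, hM⟩ := exists_bound_of_support hs h
  have hle : ∀ a ∈ s, ∀ b ∈ s, f a - f b ≤ M * |a - b| := fun a ha b hb => by
    have h1 : C a * (a - b) ≤ M * |a - b| :=
      (le_abs_self _).trans ((abs_mul _ _).trans_le (by gcongr; exact hM a ha))
    linarith [h a ha b hb]
  refine (LipschitzOnWith.of_dist_le_mul (K := M.toNNReal) fun a ha b hb => ?_).continuousOn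
  rw [Real.coe_toNNReal _ ((abs_nonneg _).trans (hM a ha)), Real.dist_eq, Real.dist_eq, abs_le]
  have := hle b hb a ha
  rw [abs_sub_comm] at this
  exact ⟨by linarith, hle a ha b hb⟩

end Support

/-! ### Unital sums of positive maps -/

section PositiveMaps

theorem PositiveLinearMap.map_real_smul {E F : Type*}
    [AddCommGroup E] [PartialOrder E] [Module ℂ E] [AddCommGroup F] [PartialOrder F] [Module ℂ F]
    (Ψ : E →ₚ[ℂ] F) (r : ℝ) (T : E) : Ψ (r • T) = r • Ψ T := by
  rw [← Complex.coe_smul, ← Complex.coe_smul, map_smul]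

theorem sum_map_algebraMap {H K : Type*}
    [NormedAddCommGroup H] [InnerProductSpace ℂ H] [NormedAddCommGroup K] [InnerProductSpace ℂ K]
    {n : ℕ} {Φ : Fin n → ((H →L[ℂ] H) →ₚ[ℂ] (K →L[ℂ] K))} (hΦ : ∑ i, Φ i 1 = 1) (r : ℝ) :
    ∑ i, Φ i (algebraMap ℝ (H →L[ℂ] H) r) = algebraMap ℝ (K →L[ℂ] K) r := by
  simp_rw [Algebra.algebraMap_eq_smul_one, PositiveLinearMap.map_real_smul, ← Finset.smul_sum, hΦ]

variable {H K : Type*}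
  [NormedAddCommGroup H] [InnerProductSpace ℂ H] [CompleteSpace H]
  [NormedAddCommGroup K] [InnerProductSpace ℂ K] [CompleteSpace K]
  {n : ℕ} {A : Fin n → (H →L[ℂ] H)} {Φ : Fin n → ((H →L[ℂ] H) →ₚ[ℂ] (K →L[ℂ] K))}

theorem isSelfAdjoint_sum_map (hA : ∀ i, IsSelfAdjoint (A i)) :
    IsSelfAdjoint (∑ i, Φ i (A i)) :=
  isSelfAdjoint_sum _ fun i _ => (hA i).map (Φ i)

theorem spectrum_sum_subset {J : Set ℝ} (hJ : J.OrdConnected) (hA : ∀ i, IsSelfAdjoint (A i))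
    (hAJ : ∀ i, spectrum ℝ (A i) ⊆ J) (hΦ : ∑ i, Φ i 1 = 1) :
    spectrum ℝ (∑ i, Φ i (A i)) ⊆ J := by
  intro s hs
  have hK : Nontrivial (K →L[ℂ] K) := by
    by_contra hK
    rw [not_nontrivial_iff_subsingleton] at hK
    simp at hs
  have hn : Nonempty (Fin n) := by
    by_contra hn
    rw [not_nonempty_iff] at hn
    simp at hΦ
  have hH : Nontrivial (H →L[ℂ] H) := by
    by_contra hH
    rw [not_nontrivial_iff_subsingleton] at hH
    simp [Subsingleton.elim (1 : H →L[ℂ] H) 0] at hΦ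
  -- All the spectra of the `A i` lie in `[l, u]`, where `l` and `u` are themselves spectral values.
  set U : Set ℝ := ⋃ i, spectrum ℝ (A i) with hU
  have hUc : IsCompact U := isCompact_iUnion fun i => spectrum.isCompact (A i)
  have hUne : U.Nonempty := by
    obtain ⟨i⟩ := hn
    obtain ⟨t, ht⟩ := ContinuousFunctionalCalculus.spectrum_nonempty (R := ℝ) (A i) (hA i)
    exact ⟨t, Set.mem_iUnion.2 ⟨i, ht⟩⟩
  have hUJ : U ⊆ J := Set.iUnion_subset hAJ
  obtain ⟨l, hl⟩ := hUc.exists_isLeast hUne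
  obtain ⟨u, hu⟩ := hUc.exists_isGreatest hUne
  have hSl : algebraMap ℝ (K →L[ℂ] K) l ≤ ∑ i, Φ i (A i) := by
    rw [← sum_map_algebraMap hΦ]
    exact Finset.sum_le_sum fun i _ => OrderHomClass.mono (Φ i)
      (algebraMap_le_of_le_spectrum (fun t ht => hl.2 (Set.mem_iUnion.2 ⟨i, ht⟩)) (hA i))
  have hSu : ∑ i, Φ i (A i) ≤ algebraMap ℝ (K →L[ℂ] K) u := by
    rw [← sum_map_algebraMap hΦ]
    exact Finset.sum_le_sum fun i _ => OrderHomClass.mono (Φ i)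
      (le_algebraMap_of_spectrum_le (fun t ht => hu.2 (Set.mem_iUnion.2 ⟨i, ht⟩)) (hA i))
  have hSA := isSelfAdjoint_sum_map (Φ := Φ) hA
  exact hJ.out (hUJ hl.1) (hUJ hu.1)
    ⟨(algebraMap_le_iff_le_spectrum hSA).1 hSl s hs, (le_algebraMap_iff_spectrum_le hSA).1 hSu s hs⟩

/-- An affine minorant of `f` on the spectra of the `A i` gives an operator inequality for the
images under a unital family of positive maps. -/
theorem affine_le_sum_map_cfc {f : ℝ → ℝ} (hA : ∀ i, IsSelfAdjoint (A i))
    (hfA : ∀ i, ContinuousOn f (spectrum ℝ (A i))) (hΦ : ∑ i, Φ i 1 = 1) (c d : ℝ)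
    (h : ∀ i, ∀ t ∈ spectrum ℝ (A i), c * t + d ≤ f t) :
    c • ∑ i, Φ i (A i) + algebraMap ℝ (K →L[ℂ] K) d ≤ ∑ i, Φ i (cfc f (A i)) := by
  rw [← sum_map_algebraMap hΦ, Finset.smul_sum, ← Finset.sum_add_distrib]
  refine Finset.sum_le_sum fun i _ => ?_
  rw [← PositiveLinearMap.map_real_smul, ← map_add]
  refine OrderHomClass.mono (Φ i) ?_
  have e : c • A i + algebraMap ℝ (H →L[ℂ] H) d = cfc (fun t => c * t + d) (A i) := by
    rw [cfc_add_const d (fun t => c * t) (A i), cfc_const_mul_id c (A i)]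
  rw [e]
  exact cfc_mono (h i)

end PositiveMaps

/-! ### Spectral measures and the Borel functional calculus -/

section Spectral

variable {K : Type*} [NormedAddCommGroup K] [InnerProductSpace ℂ K] [CompleteSpace K]
  {T : K →L[ℂ] K}

theorem isProbabilityMeasure_spectralMeasure (hT : IsSelfAdjoint T) {x : K} (hx : ‖x‖ = 1) :
    IsProbabilityMeasure (spectralMeasure T x) := by
  have h := integral_spectralMeasure T hT x 1
  rw [map_one] at h
  simp [inner_self_eq_norm_sq_to_K, hx] at h
  refine ⟨?_⟩
  rw [← ENNReal.toReal_eq_one_iff]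
  exact h

/-- Both sides are finite measures, and they integrate every continuous `h` to
`⟨h(T) p(T) x, p(T) x⟩ = ⟨(p * h * p)(T) x, x⟩`. -/
theorem spectralMeasure_cfcHom_apply (hT : IsSelfAdjoint T) (p : C(spectrum ℝ T, ℝ)) (x : K) :
    spectralMeasure T (cfcHom hT p x)
      = (spectralMeasure T x).withDensity fun t => ENNReal.ofReal (p t ^ 2) := by
  have hint : Integrable (fun t => p t ^ 2) (spectralMeasure T x) :=
    (p ^ 2).continuous.integrable_of_hasCompactSupport (.of_compactSpace _)
  have := isFiniteMeasure_withDensity_ofReal hint.2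
  refine ext_of_forall_integral_eq_of_IsFiniteMeasure fun h => ?_
  rw [integral_withDensity_eq_integral_toReal_smul (by fun_prop) (by simp)]
  have hpsa : IsSelfAdjoint (cfcHom hT p) := cfcHom_predicate hT p
  have e1 := integral_spectralMeasure T hT (cfcHom hT p x) h.toContinuousMap
  have e2 := integral_spectralMeasure T hT x (p * (h.toContinuousMap * p))
  have hsym := hpsa.isSymmetric x (cfcHom hT h.toContinuousMap (cfcHom hT p x))
  simp only [ContinuousLinearMap.coe_coe] at hsym
  rw [map_mul, map_mul] at e2
  simp only [mul_apply_eq_comp] at e2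
  rw [hsym, ← e2] at e1
  refine e1.trans (integral_congr_ae (Filter.Eventually.of_forall fun t => ?_))
  simp only [ENNReal.toReal_ofReal (sq_nonneg _), ContinuousMap.mul_apply, smul_eq_mul]
  change p t * (h t * p t) = _
  ring

variable {g : ℝ → ℝ} {M : ℝ}

theorem isSelfAdjoint_borelCalculus (hT : IsSelfAdjoint T)
    (hg : Measurable fun t : spectrum ℝ T => g t) (hM : ∀ t ∈ spectrum ℝ T, |g t| ≤ M) :
    IsSelfAdjoint (borelCalculus g T) := by
  rw [ContinuousLinearMap.isSelfAdjoint_iff_isSymmetric,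
    LinearMap.isSymmetric_iff_inner_map_self_real]
  intro x
  have := inner_borelCalculus T hT g hg M hM x
  simp only [ContinuousLinearMap.coe_coe]
  rw [this, Complex.conj_ofReal]

theorem re_inner_borelCalculus_cfcHom (hT : IsSelfAdjoint T)
    (hg : Measurable fun t : spectrum ℝ T => g t) (hM : ∀ t ∈ spectrum ℝ T, |g t| ≤ M)
    (p : C(spectrum ℝ T, ℝ)) (x : K) :
    (⟪borelCalculus g T (cfcHom hT p x), cfcHom hT p x⟫_ℂ).re
      = ∫ t, p t ^ 2 * g t ∂(spectralMeasure T x) := by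
  rw [inner_borelCalculus T hT g hg M hM, Complex.ofReal_re, spectralMeasure_cfcHom_apply,
    integral_withDensity_eq_integral_toReal_smul (by fun_prop) (by simp)]
  simp [ENNReal.toReal_ofReal, sq_nonneg]

/-- Multiplicativity of the Borel functional calculus against the operator itself. -/
theorem re_inner_borelCalculus_apply (hT : IsSelfAdjoint T)
    (hg : Measurable fun t : spectrum ℝ T => g t) (hM : ∀ t ∈ spectrum ℝ T, |g t| ≤ M) (x : K) :
    (⟪borelCalculus g T (T x), x⟫_ℂ).re = ∫ t, g t * t ∂(spectralMeasure T x) := by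
  set R := borelCalculus g T with hR
  -- Polarization: `4 * t = (t + 1) ^ 2 - (t - 1) ^ 2`, so compare the form at `T x + x`, `T x - x`.
  let i : C(spectrum ℝ T, ℝ) := (ContinuousMap.id ℝ).restrict (spectrum ℝ T)
  have hi : cfcHom hT i = T := cfcHom_id hT
  have hp : cfcHom hT (i + 1) x = T x + x := by rw [map_add, hi, map_one]; rfl
  have hq : cfcHom hT (i - 1) x = T x - x := by rw [map_sub, hi, map_one]; rfl
  have e1 := re_inner_borelCalculus_cfcHom hT hg hM (i + 1) x
  have e2 := re_inner_borelCalculus_cfcHom hT hg hM (i - 1) x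
  rw [hp] at e1
  rw [hq] at e2
  have hint : ∀ p : C(spectrum ℝ T, ℝ),
      Integrable (fun t => p t ^ 2 * g t) (spectralMeasure T x) := fun p =>
    ((p ^ 2).continuous.integrable_of_hasCompactSupport (.of_compactSpace _)).mul_bdd (c := M)
      hg.aestronglyMeasurable (Filter.Eventually.of_forall fun t => hM t t.2)
  have hsym : (⟪R x, T x⟫_ℂ).re = (⟪R (T x), x⟫_ℂ).re := by
    have h := (isSelfAdjoint_borelCalculus hT hg hM).isSymmetric x (T x)
    simp only [ContinuousLinearMap.coe_coe] at h
    rw [h, ← inner_conj_symm, Complex.conj_re]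
  have e3 : ∫ t, g t * t ∂(spectralMeasure T x)
      = (∫ t, (i + 1) t ^ 2 * g t ∂(spectralMeasure T x)
        - ∫ t, (i - 1) t ^ 2 * g t ∂(spectralMeasure T x)) / 4 := by
    rw [← integral_sub (hint _) (hint _), ← integral_div]
    refine integral_congr_ae (Filter.Eventually.of_forall fun t => ?_)
    change g t * t = (((t : ℝ) + 1) ^ 2 * g t - ((t : ℝ) - 1) ^ 2 * g t) / 4
    ring
  rw [e3, ← e1, ← e2]
  simp only [map_add, map_sub, inner_add_left, inner_add_right, inner_sub_left, inner_sub_right,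
    Complex.add_re, Complex.sub_re]
  rw [hsym]
  ring

end Spectral

/-! ### The Jensen gap -/

theorem bddAbove_jensenGapSet {K : Type*} [NormedAddCommGroup K] [InnerProductSpace ℂ K]
    (S R : K →L[ℂ] K) : BddAbove (jensenGapSet S R) := by
  have hle : ∀ (T : K →L[ℂ] K) (x : K), ‖x‖ = 1 → |(⟪T x, x⟫_ℂ).re| ≤ ‖T‖ := fun T x hx => by
    have h1 := (Complex.abs_re_le_norm _).trans (norm_inner_le_norm (𝕜 := ℂ) (T x) x)
    have h2 := T.le_opNorm x
    rw [hx, mul_one] at h1 h2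
    exact h1.trans h2
  refine ⟨‖R * S‖ + ‖S‖ * ‖R‖, ?_⟩
  rintro r ⟨x, hx, rfl⟩
  have h1 := (abs_le.1 (hle (R * S) x hx)).2
  have h2 : |(⟪S x, x⟫_ℂ).re * (⟪R x, x⟫_ℂ).re| ≤ ‖S‖ * ‖R‖ := by
    rw [abs_mul]
    exact mul_le_mul (hle S x hx) (hle R x hx) (abs_nonneg _) (norm_nonneg _)
  have h3 := (abs_le.1 h2).1
  simp only [mul_apply_eq_comp] at h1
  linarith

/-- Loewner order may be tested on unit vectors. -/
theorem le_of_forall_unit_re_inner_le {K : Type*} [NormedAddCommGroup K] [InnerProductSpace ℂ K]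
    [CompleteSpace K] {P Q : K →L[ℂ] K} (hP : IsSelfAdjoint P) (hQ : IsSelfAdjoint Q)
    (h : ∀ x, ‖x‖ = 1 → (⟪P x, x⟫_ℂ).re ≤ (⟪Q x, x⟫_ℂ).re) : P ≤ Q := by
  rw [ContinuousLinearMap.le_def, ContinuousLinearMap.isPositive_def']
  refine ⟨hQ.sub hP, fun x => ?_⟩
  rcases eq_or_ne x 0 with rfl | hx
  · simp [ContinuousLinearMap.reApplyInnerSelf_apply]
  obtain ⟨u, hu, hux⟩ : ∃ u : K, ‖u‖ = 1 ∧ x = (‖x‖ : ℂ) • u :=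
    ⟨(‖x‖ : ℂ)⁻¹ • x, by simp [norm_smul, hx], by simp [smul_smul, hx]⟩
  rw [hux, ContinuousLinearMap.reApplyInnerSelf_smul]
  refine mul_nonneg (sq_nonneg _) ?_
  rw [ContinuousLinearMap.reApplyInnerSelf_apply]
  simpa [inner_sub_left] using h u hu

/-- The integrated form of the family of supporting-line inequalities, at a unit vector. -/
theorem re_inner_cfc_le_of_support {K : Type*} [NormedAddCommGroup K] [InnerProductSpace ℂ K]
    [CompleteSpace K] {S B : K →L[ℂ] K} (hS : IsSelfAdjoint S) {f C : ℝ → ℝ}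
    (hf : ContinuousOn f (spectrum ℝ S)) (hC : Measurable fun t : spectrum ℝ S => C t) {M : ℝ}
    (hM : ∀ t ∈ spectrum ℝ S, |C t| ≤ M)
    (h : ∀ s ∈ spectrum ℝ S, C s • S + algebraMap ℝ (K →L[ℂ] K) (f s - C s * s) ≤ B)
    {x : K} (hx : ‖x‖ = 1) :
    (⟪cfc f S x, x⟫_ℂ).re ≤ (⟪B x, x⟫_ℂ).re + ((⟪borelCalculus C S (S x), x⟫_ℂ).re
      - (⟪S x, x⟫_ℂ).re * (⟪borelCalculus C S x, x⟫_ℂ).re) := by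
  have := isProbabilityMeasure_spectralMeasure hS hx
  set μ := spectralMeasure S x with hμ
  let F : C(spectrum ℝ S, ℝ) := ⟨_, hf.domRestrict⟩
  have eF : ∫ t, F t ∂μ = (⟪cfc f S x, x⟫_ℂ).re := by
    rw [cfc_apply f S, integral_spectralMeasure S hS, ← inner_conj_symm, Complex.conj_re]
  have eR : ∫ t, C t ∂μ = (⟪borelCalculus C S x, x⟫_ℂ).re := by
    rw [inner_borelCalculus S hS C hC M hM, Complex.ofReal_re]
  have eRS := re_inner_borelCalculus_apply hS hC hM x
  have iF : Integrable F μ := F.continuous.integrable_of_hasCompactSupport (.of_compactSpace _)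
  have iC : Integrable (fun t : spectrum ℝ S => C t) μ :=
    Integrable.of_bound hC.aestronglyMeasurable M (Filter.Eventually.of_forall fun t => hM t t.2)
  have iid : Integrable (fun t : spectrum ℝ S => (t : ℝ)) μ :=
    continuous_subtype_val.integrable_of_hasCompactSupport (.of_compactSpace _)
  have iCt : Integrable (fun t : spectrum ℝ S => C t * t) μ :=
    iid.bdd_mul hC.aestronglyMeasurable (c := M) (Filter.Eventually.of_forall fun t => hM t t.2)
  have key : ∀ t : spectrum ℝ S, C t * (⟪S x, x⟫_ℂ).re + F t - C t * t ≤ (⟪B x, x⟫_ℂ).re := by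
    intro t
    have h1 := h t t.2
    rw [ContinuousLinearMap.le_def] at h1
    have h2 := h1.re_inner_nonneg_left x
    have hxx : (⟪x, x⟫_ℂ).re = 1 := by simp [inner_self_eq_norm_sq_to_K, hx]
    simp only [Algebra.algebraMap_eq_smul_one, sub_apply,
      add_apply, smul_apply, one_apply_eq_self,
      inner_sub_left, inner_add_left, inner_smul_left_eq_smul, map_sub, map_add,
      RCLike.re_to_complex, Complex.real_smul, Complex.re_ofReal_mul, hxx] at h2
    change C t * (⟪S x, x⟫_ℂ).re + f t - C t * t ≤ _
    linarith
  have iCF : Integrable (fun t : spectrum ℝ S => C t * (⟪S x, x⟫_ℂ).re + F t) μ :=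
    (iC.mul_const _).add iF
  have hI := integral_mono (iCF.sub iCt) (integrable_const (μ := μ) (⟪B x, x⟫_ℂ).re) key
  simp only [Pi.sub_apply] at hI
  rw [integral_sub iCF iCt, integral_add (iC.mul_const _) iF,
    integral_mul_const, integral_const, eF, eR, ← eRS] at hI
  simp at hI
  linarith

theorem theorem2p2 {H K : Type*}
    [NormedAddCommGroup H] [InnerProductSpace ℂ H] [CompleteSpace H]
    [NormedAddCommGroup K] [InnerProductSpace ℂ K] [CompleteSpace K]
    {n : ℕ} (J : Set ℝ) (f : ℝ → ℝ) (hf : ConvexOn ℝ J f)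
    (A : Fin n → (H →L[ℂ] H)) (hA : ∀ i, IsSelfAdjoint (A i))
    (hAJ : ∀ i, spectrum ℝ (A i) ⊆ J)
    (hfA : ∀ i, ContinuousOn f (spectrum ℝ (A i)))
    (Φ : Fin n → ((H →L[ℂ] H) →ₚ[ℂ] (K →L[ℂ] K))) (hΦ : ∑ i, Φ i 1 = 1)
    (S : K →L[ℂ] K) (hS : S = ∑ i, Φ i (A i))
    (C : ℝ → ℝ) (hC : ∀ s ∈ spectrum ℝ S, ∀ t ∈ J, C s * (t - s) + f s ≤ f t) :
    BddAbove (jensenGapSet S (borelCalculus C S)) ∧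
      cfc f S ≤ ∑ i, Φ i (cfc f (A i))
        + sSup (jensenGapSet S (borelCalculus C S)) • (1 : K →L[ℂ] K) := by
  refine ⟨bddAbove_jensenGapSet _ _, ?_⟩
  subst hS
  set S := ∑ i, Φ i (A i)
  have hSA : IsSelfAdjoint S := isSelfAdjoint_sum_map hA
  have hSJ : spectrum ℝ S ⊆ J := spectrum_sum_subset hf.1.ordConnected hA hAJ hΦ
  have hsup : ∀ a ∈ spectrum ℝ S, ∀ b ∈ spectrum ℝ S, C a * (b - a) + f a ≤ f b :=
    fun a ha b hb => hC a ha b (hSJ hb)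
  have hSc : IsCompact (spectrum ℝ S) := spectrum.isCompact S
  have hfS := continuousOn_of_support hSc hsup
  have hCm : Measurable fun t : spectrum ℝ S => C t :=
    Monotone.measurable fun a b hab => monotoneOn_of_support hsup a.2 b.2 hab
  obtain ⟨M, hM⟩ := exists_bound_of_support hSc hsup
  refine le_of_forall_unit_re_inner_le (cfc_predicate f S)
    ((isSelfAdjoint_sum_map fun i => cfc_predicate f (A i)).add
      ((IsSelfAdjoint.all _).smul (IsSelfAdjoint.one _))) fun x hx => ?_
  refine (re_inner_cfc_le_of_support hSA hfS hCm hM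
    (fun s hs => affine_le_sum_map_cfc hA hfA hΦ _ _ fun i t ht => ?_) hx).trans ?_
  · linarith [hC s hs t (hAJ i ht)]
  · have hle := le_csSup (bddAbove_jensenGapSet S (borelCalculus C S)) ⟨x, hx, rfl⟩
    have hxx : (⟪x, x⟫_ℂ).re = 1 := by simp [inner_self_eq_norm_sq_to_K, hx]
    simp only [add_apply, smul_apply,
      one_apply_eq_self, inner_add_left, inner_smul_left_eq_smul, Complex.add_re,
      Complex.real_smul, Complex.re_ofReal_mul, hxx, mul_one]
    linarith
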